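/- All Banach spaces are real. For a Banach space $X$ let $B_X$, $S_X$ be its closed unit ball and unit sphere. A slice of $B_X$ is a set $S(x^*,\alpha)=\{y\in B_X : x^*(y)>\sup x^*(B_X)-\alpha\}$ with $x^*\in X^*$, $\alpha>0$. A point $x\in S_X$ is a $\Delta$-point if $\sup_{y\in S}\|x-y\|=2$ for every slice $S$ of $B_X$ containing $x$; $X$ has the diametral local diameter 2 property (DLD2P) if every $x\in S_X$ is a $\Delta$-point. A point $x\in S_X$ is a relative Daugavet-point if there are $x^*\in X^*$ with $\|x^*\|=x^*(x)=1$ and $\alpha>0$ such that $\sup_{y\in T}\|x-y\|=2$ for every slice $T$ of $B_X$ with $T\subseteq S(x^*,\alpha)$. Corollary. There exists a nonzero Banach space with the DLD2P that does not contain any relative Daugavet-point. More precisely, whenever $X$ and $Y$ are nonzero Banach spaces with the DLD2P, the $\ell_2$-sum $X\oplus_2 Y$ (with norm $\|(x,y)\|=(\|x\|^2+\|y\|^2)^{1/2}$) has the DLD2P and contains no relative Daugavet-point. -/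

import Mathlib

universe u v

namespace Diametral

variable {X : Type*} [NormedAddCommGroup X] [NormedSpace ℝ X]

/-- The slice `S(C, f, α) = {x ∈ C : f x > sup f(C) - α}` of `C` defined by the continuous linear
functional `f` and the number `α` (positive in all uses below). -/
def slice (C : Set X) (f : X →L[ℝ] ℝ) (α : ℝ) : Set X :=
  {x | x ∈ C ∧ sSup (f '' C) - α < f x}

/-- `S` is a slice of the closed unit ball `B_X`. -/
def IsSliceOfBall (S : Set X) : Prop :=
  ∃ (f : X →L[ℝ] ℝ) (α : ℝ), 0 < α ∧ S = slice (Metric.closedBall (0 : X) 1) f α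

/-- `sup_{y ∈ S} ‖x - y‖ = 2`. -/
def SupDistEqTwo (x : X) (S : Set X) : Prop :=
  IsLUB ((fun y => ‖x - y‖) '' S) 2

/-- The set `D(x)` of norm-one functionals supporting the unit ball at a point `x` of the
unit sphere. -/
def supportingFunctionals (x : X) : Set (X →L[ℝ] ℝ) :=
  {f | ‖f‖ = 1 ∧ f x = 1}

/-- `x ∈ S_X` is a `Δ`-point: `sup_{y ∈ S} ‖x - y‖ = 2` for every slice `S` of `B_X`
containing `x`. -/
def IsDeltaPoint (x : X) : Prop :=
  ‖x‖ = 1 ∧ ∀ S : Set X, IsSliceOfBall S → x ∈ S → SupDistEqTwo x S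

/-- `x` is a Daugavet-point relative to the set `S`: `sup_{y ∈ T} ‖x - y‖ = 2` for every
slice `T` of `B_X` contained in `S`. -/
def IsDaugavetRelativeTo (x : X) (S : Set X) : Prop :=
  ∀ T : Set X, IsSliceOfBall T → T ⊆ S → SupDistEqTwo x T

/-- `x ∈ S_X` is a relative Daugavet-point: it is a Daugavet-point relative to some slice
`S(f, α)` of `B_X` with `f ∈ D(x)` and `α > 0`. -/
def IsRelativeDaugavetPoint (x : X) : Prop :=
  ‖x‖ = 1 ∧ ∃ f ∈ supportingFunctionals x, ∃ α : ℝ, 0 < α ∧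
    IsDaugavetRelativeTo x (slice (Metric.closedBall (0 : X) 1) f α)

/-- The diametral local diameter 2 property: every point of the unit sphere is a `Δ`-point. -/
def HasDLD2P (X : Type*) [NormedAddCommGroup X] [NormedSpace ℝ X] : Prop :=
  ∀ x : X, ‖x‖ = 1 → IsDeltaPoint x

end Diametral

namespace Diametral

open Metric

/-! ### Slices of the ball and a scale-free form of the DLD2P. -/

section Slices

variable {X : Type*} [NormedAddCommGroup X] [NormedSpace ℝ X]

/-! The DLD2P passes to the `ℓ₂`-sum coordinatewise, once it is stated for vectors of any norm
(`hasDLD2P_iff`). Relative Daugavet-points fail by Euclidean rotundity: any slice contains a smaller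
one on which the pair of coordinate norms is close to a point of the unit circle other than
`(‖z.fst‖, ‖z.snd‖)`, so distances from `z` stay below some constant less than 2. For existence,
take both summands to be `C([0,1])`. -/

theorem sSup_image_closedBall_eq_norm (f : X →L[ℝ] ℝ) : sSup (f '' closedBall (0 : X) 1) = ‖f‖ := by
  refine csSup_eq_of_forall_le_of_forall_lt_exists_gt
    ((nonempty_closedBall.2 zero_le_one).image f) ?_ fun r hr => ?_
  · rintro _ ⟨x, hx, rfl⟩
    exact (le_abs_self _).trans (f.unit_le_opNorm x (mem_closedBall_zero_iff.1 hx))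
  · obtain ⟨x, hx, hrx⟩ := f.exists_lt_apply_of_lt_opNorm hr
    rcases le_total 0 (f x) with h | h
    · exact ⟨f x, ⟨x, by simpa using hx.le, rfl⟩, by rwa [Real.norm_of_nonneg h] at hrx⟩
    · exact ⟨f (-x), ⟨-x, by simpa using hx.le, rfl⟩, by
        rw [Real.norm_of_nonpos h] at hrx; simpa using hrx⟩

theorem exists_lt_apply_of_lt_norm (f : X →L[ℝ] ℝ) {r : ℝ} (hr : r < ‖f‖) :
    ∃ x, ‖x‖ ≤ 1 ∧ r < f x := by
  obtain ⟨_, ⟨x, hx, rfl⟩, h⟩ := exists_lt_of_lt_csSup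
    ((nonempty_closedBall.2 zero_le_one).image f) (hr.trans_eq (sSup_image_closedBall_eq_norm f).symm)
  exact ⟨x, mem_closedBall_zero_iff.1 hx, h⟩

theorem mem_slice_closedBall {f : X →L[ℝ] ℝ} {α : ℝ} {x : X} :
    x ∈ slice (closedBall (0 : X) 1) f α ↔ ‖x‖ ≤ 1 ∧ ‖f‖ - α < f x := by
  rw [slice, sSup_image_closedBall_eq_norm, Set.mem_ofPred_eq, mem_closedBall_zero_iff]

theorem exists_smul_unit_functional [Nontrivial X] (f : X →L[ℝ] ℝ) :
    ∃ g : X →L[ℝ] ℝ, ‖g‖ = 1 ∧ f = ‖f‖ • g := by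
  rcases eq_or_ne f 0 with rfl | hf
  · obtain ⟨g, hg, -⟩ := exists_dual_vector' ℝ (0 : X)
    exact ⟨g, hg, by simp⟩
  · have h : ‖f‖ ≠ 0 := norm_ne_zero_iff.2 hf
    exact ⟨‖f‖⁻¹ • f, by rw [norm_smul, norm_inv, norm_norm, inv_mul_cancel₀ h],
      by rw [smul_smul, mul_inv_cancel₀ h, one_smul]⟩

/-- Rescaling to arbitrary `x`, zero included, lets the criterion apply directly to the coordinates
of a vector in a sum. -/
theorem hasDLD2P_iff : HasDLD2P X ↔ ∀ (x : X) (f : X →L[ℝ] ℝ) (η ε : ℝ), 0 < η → 0 < ε →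
    ∃ u : X, ‖u‖ ≤ ‖x‖ ∧ f x - η < f u ∧ 2 * ‖x‖ - ε < ‖x - u‖ := by
  constructor
  · intro h x f η ε hη hε
    rcases eq_or_ne x 0 with rfl | hx
    · exact ⟨0, by simp, by simpa using hη, by simpa using hε⟩
    have hr : 0 < ‖x‖ := norm_pos_iff.2 hx
    set e : X := ‖x‖⁻¹ • x with he
    have hxe : x = ‖x‖ • e := by rw [he, smul_smul, mul_inv_cancel₀ hr.ne', one_smul]
    have hen : ‖e‖ = 1 := by rw [he, norm_smul, norm_inv, norm_norm, inv_mul_cancel₀ hr.ne']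
    have hfe : f e ≤ ‖f‖ := by
      simpa [hen] using (le_abs_self _).trans (f.le_opNorm e)
    have hlub := (h e hen).2 (slice (closedBall (0 : X) 1) f (‖f‖ - f e + η / ‖x‖))
      ⟨f, _, by have := div_pos hη hr; linarith, rfl⟩
      (mem_slice_closedBall.2 ⟨hen.le, by have := div_pos hη hr; linarith⟩)
    obtain ⟨_, ⟨u, hu, rfl⟩, hlt, -⟩ :=
      hlub.exists_between (show 2 - ε / ‖x‖ < 2 by have := div_pos hε hr; linarith)
    obtain ⟨hu1, hu2⟩ := mem_slice_closedBall.1 hu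
    refine ⟨‖x‖ • u, ?_, ?_, ?_⟩
    · rw [norm_smul, norm_norm]
      exact mul_le_of_le_one_right hr.le hu1
    · have hfx : f x = ‖x‖ * f e := by rw [he, map_smul, smul_eq_mul, mul_inv_cancel_left₀ hr.ne']
      have := mul_lt_mul_of_pos_left (show f e - η / ‖x‖ < f u by linarith) hr
      rw [mul_sub, mul_div_cancel₀ _ hr.ne'] at this
      rwa [hfx, map_smul f ‖x‖ u, smul_eq_mul]
    · have := mul_lt_mul_of_pos_left hlt hr
      rw [mul_sub, mul_div_cancel₀ _ hr.ne'] at this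
      have hxu : ‖x - ‖x‖ • u‖ = ‖x‖ * ‖e - u‖ := by
        conv_lhs => rw [show x - ‖x‖ • u = ‖x‖ • (e - u) by rw [smul_sub, ← hxe]]
        rw [norm_smul, norm_norm]
      rw [hxu]
      linarith
  · intro h x hx
    refine ⟨hx, ?_⟩
    rintro _ ⟨f, α, hα, rfl⟩ hxS
    rw [mem_slice_closedBall] at hxS
    constructor
    · rintro _ ⟨y, hy, rfl⟩
      have := norm_sub_le x y
      have := (mem_slice_closedBall.1 hy).1
      show ‖x - y‖ ≤ 2
      linarith
    · intro b hb
      refine le_of_forall_pos_lt_add fun ε hε => ?_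
      obtain ⟨u, hu1, hu2, hu3⟩ := h x f (f x - (‖f‖ - α)) ε (by linarith) hε
      have := hb ⟨u, mem_slice_closedBall.2 ⟨by linarith, by linarith⟩, rfl⟩
      simp only at this
      linarith

end Slices

/-! ### The DLD2P for continuous functions on a perfect compact space. -/

section ContinuousFunctions

variable {K : Type*} [MetricSpace K]

/-- The tent of radius `δ` and height one centred at `p`. -/
noncomputable def tent (δ : ℝ) (p : K) : C(K, ℝ) where
  toFun t := max 0 (1 - dist t p / δ)
  continuous_toFun := by fun_prop

theorem tent_nonneg (δ : ℝ) (p t : K) : 0 ≤ tent δ p t := le_max_left _ _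

theorem tent_le_one {δ : ℝ} (hδ : 0 < δ) (p t : K) : tent δ p t ≤ 1 :=
  max_le zero_le_one (sub_le_self _ (by positivity))

theorem tent_self (δ : ℝ) (p : K) : tent δ p p = 1 := by simp [tent]

theorem dist_lt_of_tent_ne_zero {δ : ℝ} (hδ : 0 < δ) {p t : K} (h : tent δ p t ≠ 0) :
    dist t p < δ := by
  by_contra! hle
  refine h (max_eq_left ?_)
  rw [sub_nonpos, le_div_iff₀ hδ]
  linarith

theorem sum_tent_le_one {δ : ℝ} (hδ : 0 < δ) (s : Finset K)
    (hs : ∀ p ∈ s, ∀ q ∈ s, p ≠ q → 2 * δ ≤ dist p q) (t : K) : ∑ p ∈ s, tent δ p t ≤ 1 := by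
  by_cases h : ∃ p ∈ s, tent δ p t ≠ 0
  · obtain ⟨p, hp, hpt⟩ := h
    rw [Finset.sum_eq_single_of_mem p hp]
    · exact tent_le_one hδ p t
    · intro q hq hqp
      by_contra hqt
      have h1 := dist_lt_of_tent_ne_zero hδ hpt
      have h2 := dist_lt_of_tent_ne_zero hδ hqt
      have h3 := hs q hq p hp hqp
      have h4 := dist_triangle_left q p t
      linarith
  · push Not at h
    rw [Finset.sum_eq_zero h]
    exact zero_le_one

theorem exists_separation (s : Finset K) :
    ∃ δ > 0, ∀ p ∈ s, ∀ q ∈ s, p ≠ q → 2 * δ ≤ dist p q := by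
  by_cases hs : (s : Set K).Nontrivial
  · refine ⟨(s : Set K).infsep / 2,
      half_pos ((s.finite_toSet.infsep_pos_iff_nontrivial).2 hs), fun p hp q hq hpq => ?_⟩
    rw [mul_div_cancel₀ _ two_ne_zero]
    exact Set.infsep_le_dist_of_mem hp hq hpq
  · rw [Set.not_nontrivial_iff] at hs
    exact ⟨1, one_pos, fun p hp q hq hpq => (hpq (hs hp hq)).elim⟩

theorem hasDLD2P_continuousMap [CompactSpace K] [Nonempty K] [PerfectSpace K] :
    HasDLD2P C(K, ℝ) := by
  rw [hasDLD2P_iff]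
  intro x f η ε hη hε
  obtain ⟨t₀, ht₀⟩ : ∃ t₀, ‖x t₀‖ = ‖x‖ := by
    obtain ⟨t₀, -, ht₀⟩ := isCompact_univ.exists_isMaxOn Set.univ_nonempty
      (continuous_norm.comp x.continuous).continuousOn
    exact ⟨t₀, le_antisymm (x.norm_coe_le_norm t₀)
      ((ContinuousMap.norm_le _ (norm_nonneg _)).2 fun t => ht₀ (Set.mem_univ t))⟩
  set s : ℝ := x t₀ with hs
  have hU : {t | |x t - s| < ε} ∈ nhds t₀ :=
    (isOpen_lt (by fun_prop) continuous_const).mem_nhds (by simpa [hs] using hε)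
  obtain ⟨N, hN⟩ := exists_nat_gt (‖f‖ * (2 * ‖x‖) / η)
  obtain ⟨T, hTU, hTN⟩ := (infinite_of_mem_nhds t₀ hU).exists_subset_card_eq N
  obtain ⟨δ, hδ, hsep⟩ := exists_separation T
  -- `x - h p` is a pointwise convex combination of `x` and `-s`, equal to `-s` at `p`. The tents do
  -- not overlap, so the sum of the `h p` stays bounded by `2 * ‖x‖` and `f (h p)` is small for some
  -- `p`.
  set h : K → C(K, ℝ) := fun p => tent δ p * (x + ContinuousMap.const K s) with hh
  have hhapp (p t : K) : h p t = tent δ p t * (x t + s) := rfl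
  have hxs (t : K) : |x t + s| ≤ 2 * ‖x‖ := by
    have h1 := abs_add_le (x t) s
    have h2 := x.norm_coe_le_norm t
    rw [Real.norm_eq_abs] at h2 ht₀
    linarith
  have hsum : ‖∑ p ∈ T, h p‖ ≤ 2 * ‖x‖ := by
    refine (ContinuousMap.norm_le _ (by positivity)).2 fun t => ?_
    rw [ContinuousMap.sum_apply]
    simp only [hhapp]
    rw [← Finset.sum_mul, norm_mul,
      Real.norm_of_nonneg (Finset.sum_nonneg fun p _ => tent_nonneg δ p t)]
    exact (mul_le_of_le_one_left (norm_nonneg _) (sum_tent_le_one hδ T hsep t)).trans (hxs t)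
  obtain ⟨p, hpT, hfp⟩ : ∃ p ∈ T, f (h p) < η := by
    by_contra! hcon
    have h1 := Finset.card_nsmul_le_sum T (fun p => f (h p)) η hcon
    rw [hTN, ← map_sum, nsmul_eq_mul] at h1
    have h2 := (le_abs_self _).trans (f.le_opNorm (∑ p ∈ T, h p))
    have h3 := mul_le_mul_of_nonneg_left hsum (norm_nonneg f)
    rw [div_lt_iff₀ hη] at hN
    linarith
  refine ⟨x - h p, ?_, ?_, ?_⟩
  · refine (ContinuousMap.norm_le _ (norm_nonneg _)).2 fun t => ?_
    have h0 := tent_nonneg δ p t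
    have h1 := tent_le_one hδ p t
    have h2 := abs_le.1 (x.norm_coe_le_norm t)
    have h3 := abs_le.1 ht₀.le
    rw [ContinuousMap.sub_apply, hhapp, Real.norm_eq_abs, abs_le]
    constructor
    · nlinarith [mul_le_mul_of_nonneg_left h3.2 h0,
        mul_le_mul_of_nonneg_left h2.1 (sub_nonneg.2 h1)]
    · nlinarith [mul_le_mul_of_nonneg_left h3.1 h0,
        mul_le_mul_of_nonneg_left h2.2 (sub_nonneg.2 h1)]
  · rw [map_sub]
    linarith
  · have h1 := (h p).norm_coe_le_norm p
    rw [hhapp, tent_self, one_mul, Real.norm_eq_abs] at h1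
    have h2 : |x p - s| < ε := hTU hpT
    have h3 : |2 * s| ≤ |x p + s| + |x p - s| := by
      have := abs_sub (x p + s) (x p - s)
      rwa [show x p + s - (x p - s) = 2 * s by ring] at this
    rw [abs_mul, abs_two, ← Real.norm_eq_abs s, ht₀] at h3
    rw [sub_sub_cancel]
    linarith

end ContinuousFunctions

/-! ### The `ℓ₂`-sum. -/

section HilbertianSum

variable {X Y : Type*} [NormedAddCommGroup X] [NormedSpace ℝ X]
  [NormedAddCommGroup Y] [NormedSpace ℝ Y]

theorem exists_apply_eq_add (F : WithLp 2 (X × Y) →L[ℝ] ℝ) :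
    ∃ (f : X →L[ℝ] ℝ) (g : Y →L[ℝ] ℝ), ∀ w, F w = f w.fst + g w.snd := by
  let e := (WithLp.prodContinuousLinearEquiv 2 ℝ X Y).symm.toContinuousLinearMap
  refine ⟨F ∘L e ∘L .inl ℝ X Y, F ∘L e ∘L .inr ℝ X Y, fun w => ?_⟩
  simp only [ContinuousLinearMap.comp_apply, ← map_add]
  congr 1
  simp [e]
  rfl

theorem hasDLD2P_withLp_two_prod (hX : HasDLD2P X) (hY : HasDLD2P Y) :
    HasDLD2P (WithLp 2 (X × Y)) := by
  rw [hasDLD2P_iff] at *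
  intro z F η ε hη hε
  obtain ⟨f, g, hF⟩ := exists_apply_eq_add F
  obtain ⟨u, hu1, hu2, hu3⟩ := hX z.fst f (η / 2) (ε / 2) (half_pos hη) (half_pos hε)
  obtain ⟨v, hv1, hv2, hv3⟩ := hY z.snd g (η / 2) (ε / 2) (half_pos hη) (half_pos hε)
  refine ⟨WithLp.toLp 2 (u, v), ?_, ?_, ?_⟩
  · rw [← sq_le_sq₀ (norm_nonneg _) (norm_nonneg _), WithLp.prod_norm_sq_eq_of_L2,
      WithLp.prod_norm_sq_eq_of_L2]
    exact add_le_add (pow_le_pow_left₀ (norm_nonneg _) hu1 2)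
      (pow_le_pow_left₀ (norm_nonneg _) hv1 2)
  · rw [hF z, hF (WithLp.toLp 2 (u, v))]
    simp only [WithLp.toLp_fst, WithLp.toLp_snd]
    linarith
  · set d := z - WithLp.toLp 2 (u, v) with hd
    have hz := WithLp.prod_norm_sq_eq_of_L2 z
    have hdn := WithLp.prod_norm_sq_eq_of_L2 d
    rw [show d.fst = z.fst - u from rfl, show d.snd = z.snd - v from rfl] at hdn
    have h1 := norm_nonneg (z.fst - u)
    have h2 := norm_nonneg (z.snd - v)
    have h3 : ‖z.fst - u‖ ≤ ‖d‖ := by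
      rw [← sq_le_sq₀ h1 (norm_nonneg _)]; nlinarith
    have h4 : ‖z.snd - v‖ ≤ ‖d‖ := by
      rw [← sq_le_sq₀ h2 (norm_nonneg _)]; nlinarith
    have h5 : (2 * ‖z.fst‖) ^ 2 < (‖z.fst - u‖ + ε / 2) ^ 2 :=
      pow_lt_pow_left₀ (by linarith) (by positivity) two_ne_zero
    have h6 : (2 * ‖z.snd‖) ^ 2 < (‖z.snd - v‖ + ε / 2) ^ 2 :=
      pow_lt_pow_left₀ (by linarith) (by positivity) two_ne_zero
    have h7 : 2 * ‖z‖ < ‖d‖ + ε := by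
      refine lt_of_pow_lt_pow_left₀ 2 (by positivity) ?_
      nlinarith
    linarith

/-- The functional `(x, y) ↦ c f(x) + d g(y)`. -/
noncomputable def prodFunctional (f : X →L[ℝ] ℝ) (g : Y →L[ℝ] ℝ) (c d : ℝ) :
    WithLp 2 (X × Y) →L[ℝ] ℝ :=
  c • f ∘L WithLp.fstL 2 ℝ X Y + d • g ∘L WithLp.sndL 2 ℝ X Y

theorem prodFunctional_apply (f : X →L[ℝ] ℝ) (g : Y →L[ℝ] ℝ) (c d : ℝ) (w : WithLp 2 (X × Y)) :
    prodFunctional f g c d w = c * f w.fst + d * g w.snd := rfl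

theorem norm_prodFunctional {f : X →L[ℝ] ℝ} {g : Y →L[ℝ] ℝ} (hf : ‖f‖ = 1) (hg : ‖g‖ = 1)
    (c d : ℝ) : ‖prodFunctional f g c d‖ = √(c ^ 2 + d ^ 2) := by
  set ρ := √(c ^ 2 + d ^ 2) with hρ
  have hρ0 : 0 ≤ ρ := Real.sqrt_nonneg _
  have hρ2 : ρ ^ 2 = c ^ 2 + d ^ 2 := Real.sq_sqrt (by positivity)
  apply le_antisymm
  · refine ContinuousLinearMap.opNorm_le_bound _ hρ0 fun w => ?_
    have h1 : |f w.fst| ≤ ‖w.fst‖ := by simpa [hf] using f.le_opNorm w.fst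
    have h2 : |g w.snd| ≤ ‖w.snd‖ := by simpa [hg] using g.le_opNorm w.snd
    have h3 := sq_le_sq' (by linarith [abs_nonneg (f w.fst)]) h1
    have h4 := sq_le_sq' (by linarith [abs_nonneg (g w.snd)]) h2
    rw [sq_abs] at h3 h4
    rw [prodFunctional_apply, Real.norm_eq_abs]
    refine abs_le_of_sq_le_sq ?_ (by positivity)
    rw [mul_pow, hρ2, WithLp.prod_norm_sq_eq_of_L2]
    have h5 := mul_le_mul_of_nonneg_left (add_le_add h3 h4)
      (show 0 ≤ c ^ 2 + d ^ 2 by positivity)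
    nlinarith [sq_nonneg (c * g w.snd - d * f w.fst)]
  · by_contra! hlt
    have hρpos : 0 < ρ := (norm_nonneg _).trans_lt hlt
    -- `f` and `g` need not attain their norms, so both are tested at level `k < 1`.
    obtain ⟨k, hk, hk1⟩ := exists_between ((div_lt_one hρpos).2 hlt)
    rw [div_lt_iff₀ hρpos] at hk
    obtain ⟨u, hu, hku⟩ := exists_lt_apply_of_lt_norm f (hk1.trans_eq hf.symm)
    obtain ⟨v, hv, hkv⟩ := exists_lt_apply_of_lt_norm g (hk1.trans_eq hg.symm)
    set w : WithLp 2 (X × Y) := WithLp.toLp 2 (c • u, d • v) with hw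
    have hwn : ‖w‖ ≤ ρ := by
      rw [← sq_le_sq₀ (norm_nonneg _) hρ0, hρ2, WithLp.prod_norm_sq_eq_of_L2]
      simp only [hw, WithLp.toLp_fst, WithLp.toLp_snd, norm_smul, mul_pow, Real.norm_eq_abs, sq_abs]
      exact add_le_add
        (mul_le_of_le_one_right (sq_nonneg c) (pow_le_one₀ (norm_nonneg u) hu))
        (mul_le_of_le_one_right (sq_nonneg d) (pow_le_one₀ (norm_nonneg v) hv))
    have h1 : prodFunctional f g c d w = c ^ 2 * f u + d ^ 2 * g v := by
      simp only [prodFunctional_apply, hw, WithLp.toLp_fst, WithLp.toLp_snd, map_smul, smul_eq_mul]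
      ring
    have h2 := (le_abs_self _).trans ((prodFunctional f g c d).le_opNorm_of_le hwn)
    rw [h1] at h2
    have h3 := mul_le_mul_of_nonneg_left hku.le (sq_nonneg c)
    have h4 := mul_le_mul_of_nonneg_left hkv.le (sq_nonneg d)
    have h5 := mul_lt_mul_of_pos_right hk hρpos
    have h6 : k * ρ * ρ = c ^ 2 * k + d ^ 2 * k := by
      rw [mul_assoc, ← sq, hρ2]; ring
    linarith

theorem exists_circle_point_near {a b : ℝ} (ha : 0 ≤ a) (hb : 0 ≤ b) (hab : a ^ 2 + b ^ 2 = 1)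
    (p : ℝ) {ε : ℝ} (hε : 0 < ε) :
    ∃ c d : ℝ, 0 ≤ c ∧ 0 ≤ d ∧ c ^ 2 + d ^ 2 = 1 ∧ c ≠ p ∧ |a - c| + |b - d| < ε := by
  set U : Set ℝ := {c | |a - c| + |b - √(1 - c ^ 2)| < ε} with hU
  have hUo : IsOpen U := isOpen_lt (by fun_prop) continuous_const
  have haU : a ∈ U := by
    have : √(1 - a ^ 2) = b := by rw [← hab, add_sub_cancel_left, Real.sqrt_sq hb]
    simpa [hU, this] using hε
  -- If `a` is 0 or 1, first move into the open interval, where a neighbourhood is infinite and can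
  -- avoid `p`.
  have hacl : a ∈ closure (Set.Ioo (0 : ℝ) 1) := by
    rw [closure_Ioo zero_ne_one]
    exact ⟨ha, by nlinarith⟩
  obtain ⟨t, htU, ht⟩ := mem_closure_iff.1 hacl U hUo haU
  obtain ⟨c, ⟨hcU, hc⟩, hcp⟩ := (infinite_of_mem_nhds t
    ((hUo.inter isOpen_Ioo).mem_nhds ⟨htU, ht⟩)).exists_notMem_finset {p}
  refine ⟨c, √(1 - c ^ 2), hc.1.le, Real.sqrt_nonneg _, ?_, by simpa using hcp, hcU⟩
  rw [Real.sq_sqrt (by nlinarith [hc.1, hc.2])]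
  ring

theorem not_isRelativeDaugavetPoint_withLp_two_prod [Nontrivial X] [Nontrivial Y]
    (z : WithLp 2 (X × Y)) : ¬ IsRelativeDaugavetPoint z := by
  rintro ⟨hz, F, ⟨hF, -⟩, α, hα, hrel⟩
  obtain ⟨f, g, hfg⟩ := exists_apply_eq_add F
  obtain ⟨f₁, hf₁, hf⟩ := exists_smul_unit_functional f
  obtain ⟨g₁, hg₁, hg⟩ := exists_smul_unit_functional g
  have hFe : F = prodFunctional f₁ g₁ ‖f‖ ‖g‖ := by
    ext w
    rw [hfg, prodFunctional_apply]
    conv_lhs => rw [hf, hg]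
    rfl
  have hab : ‖f‖ ^ 2 + ‖g‖ ^ 2 = 1 := by
    rw [hFe, norm_prodFunctional hf₁ hg₁] at hF
    exact Real.sqrt_eq_one.1 hF
  -- Tilt the weights of `F` slightly, away from the coordinate norms of `z`.
  obtain ⟨c, d, hc, hd, hcd, hcp, hnear⟩ :=
    exists_circle_point_near (norm_nonneg f) (norm_nonneg g) hab ‖z.fst‖ (half_pos hα)
  set D := (‖z.fst‖ - c) ^ 2 + (‖z.snd‖ - d) ^ 2 with hD
  have hDpos : 0 < D := by
    have : 0 < (‖z.fst‖ - c) ^ 2 := sq_pos_of_ne_zero (sub_ne_zero.2 hcp.symm)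
    positivity
  set β := min (D / 8) (α / 2) with hβ
  have hβ1 : β ≤ D / 8 := min_le_left _ _
  have hβ2 : β ≤ α / 2 := min_le_right _ _
  have hβpos : 0 < β := lt_min (by positivity) (by positivity)
  set G := prodFunctional f₁ g₁ c d with hG
  have hGn : ‖G‖ = 1 := by rw [hG, norm_prodFunctional hf₁ hg₁, hcd, Real.sqrt_one]
  have hlub := hrel (slice (closedBall 0 1) G β) ⟨G, β, hβpos, rfl⟩ ?_
  · have hub : √(4 - D / 4) ∈ upperBounds
        ((fun w => ‖z - w‖) '' slice (closedBall 0 1) G β) := by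
      rintro _ ⟨w, hw, rfl⟩
      obtain ⟨hw1, hw2⟩ := mem_slice_closedBall.1 hw
      rw [hGn, hG, prodFunctional_apply] at hw2
      have h1 : f₁ w.fst ≤ ‖w.fst‖ := by
        simpa [hf₁] using (le_abs_self _).trans (f₁.le_opNorm w.fst)
      have h2 : g₁ w.snd ≤ ‖w.snd‖ := by
        simpa [hg₁] using (le_abs_self _).trans (g₁.le_opNorm w.snd)
      have h3 := mul_le_mul_of_nonneg_left h1 hc
      have h4 := mul_le_mul_of_nonneg_left h2 hd
      have h5 := WithLp.prod_norm_sq_eq_of_L2 w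
      have h6 := WithLp.prod_norm_sq_eq_of_L2 z
      have h7 : ‖w‖ ^ 2 ≤ 1 := pow_le_one₀ (norm_nonneg _) hw1
      rw [hz] at h6
      have h8 := pow_le_pow_left₀ (norm_nonneg _) (norm_sub_le z.fst w.fst) 2
      have h9 := pow_le_pow_left₀ (norm_nonneg _) (norm_sub_le z.snd w.snd) 2
      refine Real.le_sqrt_of_sq_le ?_
      rw [WithLp.prod_norm_sq_eq_of_L2, WithLp.sub_fst, WithLp.sub_snd]
      -- With `p`, `q`, `r` the planar points of `z`, `w` and `(c, d)`: `|q - r|² ≤ 2β ≤ D/4` and `D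
      -- ≤ 2|p - q|² + 2|q - r|²` give `|p - q|² ≥ D/4`; the parallelogram law concludes.
      nlinarith [sq_nonneg (‖z.fst‖ - 2 * ‖w.fst‖ + c), sq_nonneg (‖z.snd‖ - 2 * ‖w.snd‖ + d)]
    have h1 := hlub.2 hub
    have h2 : √(4 - D / 4) < 2 := (Real.sqrt_lt' two_pos).2 (by linarith)
    linarith
  · intro w hw
    obtain ⟨hw1, hw2⟩ := mem_slice_closedBall.1 hw
    refine mem_slice_closedBall.2 ⟨hw1, ?_⟩
    rw [hGn, hG, prodFunctional_apply] at hw2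
    rw [hF, hFe, prodFunctional_apply]
    have h1 : |f₁ w.fst| ≤ 1 := by
      simpa [hf₁] using f₁.le_of_opNorm_le_of_le hf₁.le ((WithLp.norm_fst_le _ w).trans hw1)
    have h2 : |g₁ w.snd| ≤ 1 := by
      simpa [hg₁] using g₁.le_of_opNorm_le_of_le hg₁.le ((WithLp.norm_snd_le _ w).trans hw1)
    have h3 := mul_le_of_le_one_right (abs_nonneg (‖f‖ - c)) h1
    have h4 := mul_le_of_le_one_right (abs_nonneg (‖g‖ - d)) h2
    rw [← abs_mul] at h3 h4
    have h5 := neg_abs_le ((‖f‖ - c) * f₁ w.fst)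
    have h6 := neg_abs_le ((‖g‖ - d) * g₁ w.snd)
    linarith

end HilbertianSum

end Diametral

theorem mainTheorem7 :
    (∃ (Z : Type) (_ : NormedAddCommGroup Z) (_ : NormedSpace ℝ Z),
      CompleteSpace Z ∧ Nontrivial Z ∧ Diametral.HasDLD2P Z ∧
        ¬ ∃ z : Z, Diametral.IsRelativeDaugavetPoint z) ∧
    (∀ (X : Type u) (Y : Type v)
      [NormedAddCommGroup X] [NormedSpace ℝ X] [CompleteSpace X] [Nontrivial X]
      [NormedAddCommGroup Y] [NormedSpace ℝ Y] [CompleteSpace Y] [Nontrivial Y],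
      Diametral.HasDLD2P X → Diametral.HasDLD2P Y →
        Diametral.HasDLD2P (WithLp 2 (X × Y)) ∧
          ¬ ∃ z : WithLp 2 (X × Y), Diametral.IsRelativeDaugavetPoint z) := by
  have hC : Diametral.HasDLD2P C(unitInterval, ℝ) := Diametral.hasDLD2P_continuousMap
  refine ⟨⟨WithLp 2 (C(unitInterval, ℝ) × C(unitInterval, ℝ)), inferInstance, inferInstance,
      inferInstance, (WithLp.equiv 2 _).nontrivial, ?_, ?_⟩, ?_⟩
  · exact Diametral.hasDLD2P_withLp_two_prod hC hC
  · exact fun ⟨z, hz⟩ => Diametral.not_isRelativeDaugavetPoint_withLp_two_prod z hz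
  · intro X Y _ _ _ _ _ _ _ _ hX hY
    exact ⟨Diametral.hasDLD2P_withLp_two_prod hX hY,
      fun ⟨z, hz⟩ => Diametral.not_isRelativeDaugavetPoint_withLp_two_prod z hz⟩
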